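/- Let $k\ge 1$ be an integer and let $\gamma,\beta>0$. There are constants $c,C>0$, depending only on $k,\gamma,\beta$, such that the following holds for all integers $d\ge k$, all unit vectors $x\in\mathbb{R}^d$ and all integers $n\ge cd$. Let $V_1,\dots,V_n$ be independent random $k$-dimensional subspaces of $\mathbb{R}^d$, each distributed according to $\sigma_k$, the $O(d)$-invariant probability measure induced by the Haar measure of $O(d)$ on the Grassmannian of $k$-dimensional subspaces. Write $P_V$ for the matrix of the orthogonal projector onto $V$, put $E_j=\{\sqrt{d/k}\,\|P_{V_j}x\|\le 2\beta\}$ and $$Y=\frac{d}{nk}\sum_{j=1}^n\lambda_jP_{V_j},\qquad \lambda_j=\alpha-d\,\|P_{V_j}x\|^2\,1_{E_j},\qquad \alpha=\frac{d^2}{k}\,\mathbb{E}\big(\|P_{V_j}x\|^4\,1_{E_j}\big)$$ (the value of $\alpha$ does not depend on $j$). Let $Y_T$ be the orthogonal projection of $Y$, with respect to the inner product $\langle A,B\rangle=\operatorname{trace}(A^{*}B)$ on $\mathbb{R}^{d\times d}$, onto $T=\{xy^{*}+yx^{*}:y\in\mathbb{R}^d\}$, and let $\|\cdot\|_1$ be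 the nuclear norm (the sum of the singular values). Then $$\|Y_T\|_1\le\gamma$$ with probability at least $1-e^{-Cn}$. -/

import Mathlib

open MeasureTheory ProbabilityTheory

noncomputable section

namespace PhaseRetrieval

/-- The Euclidean space `ℝ^d`. -/
abbrev Euc (d : ℕ) : Type := EuclideanSpace ℝ (Fin d)

/-- The real `d × d` matrices. -/
abbrev Mat (d : ℕ) : Type := Matrix (Fin d) (Fin d) ℝ

/-- The orthogonal group `O(d)` (over `ℝ` the conjugate transpose is the transpose). -/
abbrev OrthGroup (d : ℕ) : Type := Matrix.unitaryGroup (Fin d) ℝ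

instance (d : ℕ) : MeasurableSpace (OrthGroup d) := borel _

instance (d : ℕ) : BorelSpace (OrthGroup d) := ⟨rfl⟩

instance (d : ℕ) : CompactSpace (OrthGroup d) := by
  have hK : IsCompact ((Set.Icc (-1 : ℝ) 1).matrix : Set (Mat d)) := isCompact_Icc.matrix
  have hc : IsClosed ((Matrix.unitaryGroup (Fin d) ℝ : Submonoid (Mat d)) : Set (Mat d)) :=
    isClosed_unitary
  refine isCompact_iff_compactSpace.mp (hK.of_isClosed_subset hc fun U hU i j => ?_)
  have h := entry_norm_bound_of_unitary (𝕜 := ℝ) hU i j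
  rw [Real.norm_eq_abs] at h
  exact abs_le.mp h

/-- The normalized (total mass one) Haar measure on `O(d)`. -/
def haarOrth (d : ℕ) : Measure (OrthGroup d) := Measure.haarMeasure ⊤

instance (d : ℕ) : IsProbabilityMeasure (haarOrth d) :=
  ⟨Measure.haarMeasure_self (K₀ := (⊤ : TopologicalSpace.PositiveCompacts (OrthGroup d)))⟩

/-- The real Grassmann space: the `k`-dimensional linear subspaces of `ℝ^d`. -/
def Grassmannian (k d : ℕ) : Type := {V : Submodule ℝ (Euc d) // Module.finrank ℝ V = k}

/-- The matrix `P_V` of the orthogonal projector onto `V`. -/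
def projMatrix {k d : ℕ} (V : Grassmannian k d) : Mat d :=
  (Matrix.toEuclideanCLM (n := Fin d) (𝕜 := ℝ)).symm V.1.starProjection

/-- The norm `‖P_V x‖` of the component of `x` in `V`. -/
def projNorm {k d : ℕ} (V : Grassmannian k d) (x : Euc d) : ℝ := ‖V.1.starProjection x‖

/-- Subspaces are identified with their orthogonal projectors; this gives the topology. -/
instance (k d : ℕ) : TopologicalSpace (Grassmannian k d) :=
  TopologicalSpace.induced projMatrix inferInstance

instance (k d : ℕ) : MeasurableSpace (Grassmannian k d) := borel _

instance (k d : ℕ) : BorelSpace (Grassmannian k d) := ⟨rfl⟩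

/-- An orthogonal matrix as a linear isometry of `ℝ^d`. -/
def orthIsometry {d : ℕ} (U : OrthGroup d) : Euc d ≃ₗᵢ[ℝ] Euc d :=
  Unitary.linearIsometryEquiv
    ⟨Matrix.toEuclideanCLM (n := Fin d) (𝕜 := ℝ) U.1, Unitary.map_mem _ U.2⟩

/-- The action of `O(d)` on the Grassmann space: `U` sends `V` to its image `U V`. -/
def rotate {k d : ℕ} (U : OrthGroup d) (V : Grassmannian k d) : Grassmannian k d :=
  ⟨V.1.map ((orthIsometry U).toLinearEquiv : Euc d →ₗ[ℝ] Euc d),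
    (LinearEquiv.finrank_map_eq _ _).trans V.2⟩

/-- The subspace of `ℝ^d` spanned by the first `k` canonical basis vectors. -/
def basePoint (k d : ℕ) (hkd : k ≤ d) : Grassmannian k d :=
  ⟨Submodule.span ℝ
      (Set.range fun i : Fin k => EuclideanSpace.basisFun (Fin d) ℝ (Fin.castLE hkd i)), by
    have h : LinearIndependent ℝ
        (fun i : Fin k => EuclideanSpace.basisFun (Fin d) ℝ (Fin.castLE hkd i)) :=
      (EuclideanSpace.basisFun (Fin d) ℝ).orthonormal.linearIndependent.comp _
        (Fin.castLE_injective hkd)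
    simpa using finrank_span_eq_card h⟩

/-- The `O(d)`-invariant probability measure `σ_k` on the Grassmann space that is induced by the
Haar measure on `O(d)`: the law of `U V₀` for a Haar distributed `U`. -/
def grassmannMeasure (k d : ℕ) (hkd : k ≤ d) : Measure (Grassmannian k d) :=
  (haarOrth d).map fun U => rotate U (basePoint k d hkd)

theorem projMatrix_rotate {k d : ℕ} (U : OrthGroup d) (V : Grassmannian k d) :
    projMatrix (rotate U V) = (U : Mat d) * projMatrix V * star (U : Mat d) := by
  apply EquivLike.injective (Matrix.toEuclideanCLM (n := Fin d) (𝕜 := ℝ))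
  rw [map_mul, map_mul, map_star]
  unfold projMatrix rotate
  rw [StarAlgEquiv.apply_symm_apply, StarAlgEquiv.apply_symm_apply]
  ext1 x
  exact Submodule.starProjection_map_apply (orthIsometry U) V.1 x

theorem continuous_rotate {k d : ℕ} (V : Grassmannian k d) :
    Continuous fun U : OrthGroup d => rotate U V := by
  refine continuous_induced_rng.mpr ?_
  have h : (projMatrix ∘ fun U : OrthGroup d => rotate U V)
      = fun U : OrthGroup d => (U : Mat d) * projMatrix V * star (U : Mat d) :=
    funext fun U => projMatrix_rotate U V
  rw [h]
  fun_prop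

instance (k d : ℕ) (hkd : k ≤ d) : IsProbabilityMeasure (grassmannMeasure k d hkd) :=
  Measure.isProbabilityMeasure_map (continuous_rotate _).measurable.aemeasurable

/-- A `d × d` matrix, read as the vector of its `d²` entries. The Euclidean inner product of the
entry vectors is the inner product `trace (Aᵀ B)` of matrices, see `inner_entries`. -/
def entries (d : ℕ) : Mat d ≃ₗ[ℝ] EuclideanSpace ℝ (Fin d × Fin d) where
  toFun A := WithLp.toLp 2 fun p => A p.1 p.2
  invFun v := Matrix.of fun i j => v (i, j)
  map_add' _ _ := rfl
  map_smul' _ _ := rfl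
  left_inv _ := rfl
  right_inv _ := rfl

theorem inner_entries {d : ℕ} (A B : Mat d) :
    inner ℝ (entries d A) (entries d B) = (A.transpose * B).trace := by
  have h (A : Mat d) (i j : Fin d) : entries d A (i, j) = A i j := rfl
  simp only [h, PiLp.inner_apply, Matrix.trace, Matrix.diag, Matrix.mul_apply, Matrix.transpose_apply, Fintype.sum_prod_type,
    RCLike.inner_apply, conj_trivial]
  rw [Finset.sum_comm]
  simp only [mul_comm]

/-- The tangent space `T = T_x = {x yᵀ + y xᵀ : y ∈ ℝ^d}`. -/
def tangentSpace {d : ℕ} (x : Euc d) : Submodule ℝ (Mat d) where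
  carrier := {A | ∃ y : Euc d,
    A = Matrix.vecMulVec x.ofLp y.ofLp + Matrix.vecMulVec y.ofLp x.ofLp}
  zero_mem' := ⟨0, by simp⟩
  add_mem' := by
    rintro _ _ ⟨y, rfl⟩ ⟨z, rfl⟩
    refine ⟨y + z, ?_⟩
    rw [WithLp.ofLp_add, Matrix.vecMulVec_add, Matrix.add_vecMulVec]
    abel
  smul_mem' := by
    rintro r _ ⟨y, rfl⟩
    refine ⟨r • y, ?_⟩
    rw [WithLp.ofLp_smul, Matrix.vecMulVec_smul, Matrix.smul_vecMulVec, smul_add]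

/-- The orthogonal projection `Z_T` of a matrix `Z` onto the tangent space `T = T_x`, with respect
to the inner product `trace (Aᵀ B)`. -/
def tangentProj {d : ℕ} (x : Euc d) (Z : Mat d) : Mat d :=
  (entries d).symm
    (((tangentSpace x).map (entries d : Mat d →ₗ[ℝ] EuclideanSpace ℝ (Fin d × Fin d))).starProjection
      (entries d Z))

/-- The nuclear norm: the sum of the singular values. -/
def nuclearNorm {d : ℕ} (A : Mat d) : ℝ :=
  ∑ i ∈ Finset.range d, (Matrix.toEuclideanLin A).singularValues i

/-- The cut-off event `√(d/k) ‖P_V x‖ ≤ 2 β`, as a set of subspaces. -/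
def cutoff (k : ℕ) {d : ℕ} (β : ℝ) (x : Euc d) : Set (Grassmannian k d) :=
  {V | Real.sqrt (d / k) * projNorm V x ≤ 2 * β}

/-- The constant `α = (d²/k) 𝔼 (‖P_V x‖⁴ 1_E)`, where `V` is distributed according to `σ_k`. -/
def certAlpha (k d : ℕ) (hkd : k ≤ d) (β : ℝ) (x : Euc d) : ℝ :=
  (d : ℝ) ^ 2 / k *
    ∫ V, (cutoff k β x).indicator (fun V => projNorm V x ^ 4) V ∂(grassmannMeasure k d hkd)

/-- The coefficient `λ = α - d ‖P_V x‖² 1_E` that belongs to the subspace `V`. -/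
def certCoeff (k d : ℕ) (hkd : k ≤ d) (β : ℝ) (x : Euc d) (V : Grassmannian k d) : ℝ :=
  certAlpha k d hkd β x - d * (cutoff k β x).indicator (fun V => projNorm V x ^ 2) V

/-- The truncated dual certificate `Y = (d/(nk)) ∑ⱼ λⱼ P_{Vⱼ}`. -/
def dualCertificate (k d : ℕ) (hkd : k ≤ d) (β : ℝ) (x : Euc d) {n : ℕ}
    (V : Fin n → Grassmannian k d) : Mat d :=
  ((d : ℝ) / (n * k)) • ∑ j, certCoeff k d hkd β x (V j) • projMatrix (V j)

end PhaseRetrieval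

end

/-! For symmetric `Z` and a unit vector `x`, the matrix `Z_T` has rank at most two and is determined
by `Z x`, so `‖Z_T‖₁ ≤ 4 ‖Z x‖`. It remains to bound the vector `Y x`, the mean of `n` independent
copies of `ξ = (d/k) λ P_V x`.

The value of `α` makes `⟨x, ξ⟩` centred, and the reflection across the line `ℝ x` makes `⟨u, ξ⟩`
centred for every `u` (`integral_certCoeff_mul_inner`). The cut-off bounds `|λ|` by `4β²k`, so `|⟨u,
ξ⟩|` is at most a multiple of `d (‖P_V u‖² + ‖P_V x‖²)`. Such quantities have exponential moments
bounded independently of `d` (`integral_exp_projNorm_sq_le`): by invariance a unit vector may be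
replaced by a normalized random sign vector, for which the bound is elementary. Hence the moment
generating function of `⟨u, ξ⟩` at small `s` is at most `exp (K s²)`, with `K` depending only on `k`
and `β`.

Averaging over `u` in the unit ball turns these bounds into one for the norm of the sum at the price
of a factor `4 ^ d` (`lintegral_exp_norm_le_of_forall_inner`). Markov's inequality concludes; the
factor `4 ^ d` is absorbed because `n ≥ c d`. -/

/-! ### Sums of singular values -/

theorem LinearMap.singularValues_le_of_norm_le {E F : Type*}
    [NormedAddCommGroup E] [InnerProductSpace ℝ E] [FiniteDimensional ℝ E]
    [NormedAddCommGroup F] [InnerProductSpace ℝ F] [FiniteDimensional ℝ F]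
    (T : E →ₗ[ℝ] F) {M : ℝ} (hM0 : 0 ≤ M) (hM : ∀ v, ‖T v‖ ≤ M * ‖v‖) (i : ℕ) :
    T.singularValues i ≤ M := by
  by_cases hi : i < Module.finrank ℝ E
  · obtain ⟨v, hv⟩ := (T.hasEigenvalue_adjoint_comp_self_sq_singularValues hi).exists_hasEigenvector
    have hv0 : 0 < ‖v‖ := norm_pos_iff.mpr hv.2
    have h1 : (LinearMap.adjoint T ∘ₗ T) v = T.singularValues i ^ 2 • v := hv.apply_eq_smul
    have h2 : ‖T v‖ ^ 2 = T.singularValues i ^ 2 * ‖v‖ ^ 2 := by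
      rw [← real_inner_self_eq_norm_sq, ← LinearMap.adjoint_inner_left, ← LinearMap.comp_apply, h1,
        real_inner_smul_left, real_inner_self_eq_norm_sq]
    have h3 : (T.singularValues i * ‖v‖) ^ 2 ≤ (M * ‖v‖) ^ 2 := by
      rw [mul_pow, ← h2]
      exact pow_le_pow_left₀ (norm_nonneg _) (hM v) 2
    exact le_of_mul_le_mul_right (le_of_sq_le_sq h3 (by positivity)) hv0
  · rw [T.singularValues_of_finrank_le (not_lt.mp hi)]
    exact hM0

/-- Only as many singular values as the rank are nonzero, and each is at most the operator norm. -/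
theorem LinearMap.sum_singularValues_le {E F : Type*}
    [NormedAddCommGroup E] [InnerProductSpace ℝ E] [FiniteDimensional ℝ E]
    [NormedAddCommGroup F] [InnerProductSpace ℝ F] [FiniteDimensional ℝ F]
    (T : E →ₗ[ℝ] F) {M : ℝ} (hM0 : 0 ≤ M) (hM : ∀ v, ‖T v‖ ≤ M * ‖v‖) (n : ℕ) :
    ∑ i ∈ Finset.range n, T.singularValues i ≤ Module.finrank ℝ T.range * M := by
  have h : ∑ i ∈ Finset.range n, T.singularValues i ≤ ∑ i ∈ T.singularValues.support,
      T.singularValues i := by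
    rw [← Finset.sum_filter_ne_zero]
    exact Finset.sum_le_sum_of_subset_of_nonneg
      (fun i hi => Finsupp.mem_support_iff.mpr (Finset.mem_filter.mp hi).2)
      fun i _ _ => T.singularValues_nonneg i
  refine h.trans ((Finset.sum_le_card_nsmul _ _ M
    fun i _ => T.singularValues_le_of_norm_le hM0 hM i).trans_eq ?_)
  rw [T.card_support_singularValues, nsmul_eq_mul]

/-! ### Projection onto the tangent space -/

namespace PhaseRetrieval

/-- The symmetric rank-two matrix `x yᵀ + y xᵀ`. -/
noncomputable def symOuter {d : ℕ} (x y : Euc d) : Mat d :=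
  Matrix.vecMulVec x.ofLp y.ofLp + Matrix.vecMulVec y.ofLp x.ofLp

theorem toEuclideanLin_symOuter {d : ℕ} (x y v : Euc d) :
    Matrix.toEuclideanLin (symOuter x y) v = inner ℝ y v • x + inner ℝ x v • y := by
  ext i
  simp only [symOuter, Matrix.toLpLin_apply, Matrix.add_mulVec, Matrix.vecMulVec_mulVec, PiLp.add_apply,
    PiLp.smul_apply, PiLp.inner_apply, dotProduct, RCLike.inner_apply, conj_trivial, Pi.add_apply,
    Pi.smul_apply, smul_eq_mul, MulOpposite.smul_eq_mul_unop, MulOpposite.unop_op]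
  simp only [mul_comm]

theorem nuclearNorm_symOuter_le {d : ℕ} (x y : Euc d) :
    nuclearNorm (symOuter x y) ≤ 4 * (‖x‖ * ‖y‖) := by
  have hM : ∀ v, ‖Matrix.toEuclideanLin (symOuter x y) v‖ ≤ (2 * (‖x‖ * ‖y‖)) * ‖v‖ := by
    intro v
    rw [toEuclideanLin_symOuter]
    refine (norm_add_le _ _).trans ?_
    rw [norm_smul, norm_smul]
    have h1 := mul_le_mul_of_nonneg_right (norm_inner_le_norm (𝕜 := ℝ) y v) (norm_nonneg x)
    have h2 := mul_le_mul_of_nonneg_right (norm_inner_le_norm (𝕜 := ℝ) x v) (norm_nonneg y)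
    linarith
  refine (LinearMap.sum_singularValues_le _ (by positivity) hM d).trans ?_
  have hr : Module.finrank ℝ (Matrix.toEuclideanLin (symOuter x y)).range ≤ 2 := by
    have hsub : (Matrix.toEuclideanLin (symOuter x y)).range ≤
        Submodule.span ℝ (({x, y} : Finset (Euc d)) : Set (Euc d)) := by
      rintro _ ⟨v, rfl⟩
      rw [toEuclideanLin_symOuter]
      exact add_mem (Submodule.smul_mem _ _ (Submodule.subset_span (by simp)))
        (Submodule.smul_mem _ _ (Submodule.subset_span (by simp)))
    exact (Submodule.finrank_mono hsub).trans
      ((finrank_span_finset_le_card _).trans Finset.card_le_two)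
  have hr' : (Module.finrank ℝ (Matrix.toEuclideanLin (symOuter x y)).range : ℝ) ≤ 2 := by
    exact_mod_cast hr
  nlinarith [mul_nonneg (norm_nonneg x) (norm_nonneg y)]

theorem symOuter_mem_tangentSpace {d : ℕ} (x y : Euc d) : symOuter x y ∈ tangentSpace x :=
  ⟨y, rfl⟩

theorem inner_entries_symOuter {d : ℕ} {Z : Mat d} (hZ : Z.transpose = Z) (x y : Euc d) :
    inner ℝ (entries d Z) (entries d (symOuter x y))
      = 2 * inner ℝ (Matrix.toEuclideanLin Z x) y := by
  have hs : ∀ i j, Z i j = Z j i := fun i j => congrFun (congrFun hZ j) i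
  rw [inner_entries, hZ, symOuter, Matrix.mul_add, Matrix.trace_add, Matrix.mul_vecMulVec,
    Matrix.mul_vecMulVec, Matrix.trace_vecMulVec, Matrix.trace_vecMulVec]
  have h1 : (Z.mulVec y.ofLp) ⬝ᵥ x.ofLp = (Z.mulVec x.ofLp) ⬝ᵥ y.ofLp := by
    rw [dotProduct_comm, Matrix.dotProduct_mulVec, ← Matrix.mulVec_transpose, hZ]
  have h2 : inner ℝ (Matrix.toEuclideanLin Z x) y = (Z.mulVec x.ofLp) ⬝ᵥ y.ofLp := by
    simp only [PiLp.inner_apply, dotProduct, RCLike.inner_apply, conj_trivial,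
      Matrix.toLpLin_apply, mul_comm]
  rw [h1, h2, two_mul]

theorem transpose_symOuter {d : ℕ} (x y : Euc d) : (symOuter x y).transpose = symOuter x y := by
  rw [symOuter, Matrix.transpose_add, Matrix.transpose_vecMulVec, Matrix.transpose_vecMulVec,
    add_comm]

/-- A symmetric matrix `A` pairs with `x zᵀ + z xᵀ` to `2 ⟨A x, z⟩`, so the projection is the
element of `T` that agrees with `Z` at `x`. The equation `⟨y, x⟩ x + y = Z x` forces this `y`. -/
theorem tangentProj_eq_symOuter {d : ℕ} {x : Euc d} (hx : ‖x‖ = 1) {Z : Mat d}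
    (hZ : Z.transpose = Z) :
    tangentProj x Z = symOuter x (Matrix.toEuclideanLin Z x -
      (inner ℝ x (Matrix.toEuclideanLin Z x) / 2) • x) := by
  set w := Matrix.toEuclideanLin Z x with hw
  set y := w - (inner ℝ x w / 2) • x with hy
  rw [tangentProj, LinearEquiv.symm_apply_eq]
  refine Submodule.eq_starProjection_of_mem_of_inner_eq_zero
    (Submodule.mem_map_of_mem (symOuter_mem_tangentSpace x y)) ?_
  rintro _ ⟨_, ⟨z, rfl⟩, rfl⟩
  have hxx : inner ℝ x x = 1 := by rw [real_inner_self_eq_norm_sq, hx, one_pow]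
  change inner ℝ (entries d Z - entries d (symOuter x y)) (entries d (symOuter x z)) = 0
  rw [inner_sub_left, inner_entries_symOuter hZ, inner_entries_symOuter (transpose_symOuter x y),
    toEuclideanLin_symOuter, ← hw, hxx, hy, real_inner_comm]
  simp only [inner_add_right, inner_sub_left, inner_sub_right, real_inner_smul_left,
    real_inner_smul_right, hxx, real_inner_comm z, real_inner_comm x w]
  ring

/-- Removing half of the component of `Z x` along `x` does not increase its norm. -/
theorem nuclearNorm_tangentProj_le {d : ℕ} {x : Euc d} (hx : ‖x‖ = 1) {Z : Mat d}
    (hZ : Z.transpose = Z) :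
    nuclearNorm (tangentProj x Z) ≤ 4 * ‖Matrix.toEuclideanLin Z x‖ := by
  rw [tangentProj_eq_symOuter hx hZ]
  refine (nuclearNorm_symOuter_le _ _).trans ?_
  rw [hx, one_mul]
  set w := Matrix.toEuclideanLin Z x
  have h : ‖w - (inner ℝ x w / 2) • x‖ ^ 2 ≤ ‖w‖ ^ 2 := by
    rw [norm_sub_sq_real, real_inner_smul_right, norm_smul, hx, mul_one, Real.norm_eq_abs, sq_abs,
      real_inner_comm w x]
    nlinarith [sq_nonneg (inner ℝ x w)]
  linarith [le_of_sq_le_sq h (norm_nonneg w)]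

end PhaseRetrieval

/-! ### Exponential moments of centred variables and of norms -/

theorem Real.exp_le_one_add_add_sq_mul_exp_abs (z : ℝ) :
    Real.exp z ≤ 1 + z + z ^ 2 * Real.exp |z| := by
  have h1 : 1 ≤ Real.exp |z| := Real.one_le_exp (abs_nonneg z)
  rcases le_or_gt |z| 1 with hz | hz
  · have h := (abs_le.mp (Real.abs_exp_sub_one_sub_id_le hz)).2
    nlinarith [sq_nonneg z]
  · rcases lt_abs.mp hz with hz' | hz'
    · have h2 : Real.exp z ≤ Real.exp |z| := Real.exp_le_exp.mpr (le_abs_self z)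
      nlinarith [mul_le_mul_of_nonneg_right (one_le_pow₀ hz'.le (n := 2)) (zero_le_one.trans h1)]
    · have h2 : Real.exp z ≤ 1 := Real.exp_le_one_iff.mpr (by linarith)
      nlinarith [mul_le_mul_of_nonneg_left h1 (sq_nonneg z)]

/-- Half of the exponent `θ |y|` pays for `y ^ 2`, the other half for `exp |s y|`. The linear term
stays exact, so that it disappears for centred variables. -/
theorem Real.exp_mul_le_of_le_half {θ s : ℝ} (hθ : 0 < θ) (hs0 : 0 ≤ s) (hs : s ≤ θ / 2) (y : ℝ) :
    Real.exp (s * y) ≤ 1 + s * y + 8 / θ ^ 2 * s ^ 2 * Real.exp (θ * |y|) := by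
  refine (Real.exp_le_one_add_add_sq_mul_exp_abs (s * y)).trans (add_le_add_right ?_ _)
  have h1 : (θ / 2 * |y|) ^ 2 / 2 ≤ Real.exp (θ / 2 * |y|) := by
    have := Real.quadratic_le_exp_of_nonneg (x := θ / 2 * |y|) (by positivity)
    have h0 : 0 ≤ θ / 2 * |y| := by positivity
    linarith
  have h2 : Real.exp |s * y| ≤ Real.exp (θ / 2 * |y|) := by
    rw [abs_mul, abs_of_nonneg hs0]
    gcongr
  have h3 : Real.exp (θ * |y|) = Real.exp (θ / 2 * |y|) * Real.exp (θ / 2 * |y|) := by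
    rw [← Real.exp_add]; ring_nf
  have h4 : y ^ 2 ≤ 8 / θ ^ 2 * Real.exp (θ / 2 * |y|) := by
    rw [div_mul_eq_mul_div, le_div_iff₀ (by positivity)]
    rw [mul_pow, sq_abs] at h1
    linarith
  calc (s * y) ^ 2 * Real.exp |s * y|
      ≤ s ^ 2 * (8 / θ ^ 2 * Real.exp (θ / 2 * |y|)) * Real.exp (θ / 2 * |y|) := by
        rw [mul_pow]; gcongr
    _ = _ := by rw [h3]; ring

theorem integral_exp_mul_le_of_integral_eq_zero {Ω : Type*} [MeasurableSpace Ω] {μ : Measure Ω}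
    [IsProbabilityMeasure μ] {Y : Ω → ℝ} (hY : AEStronglyMeasurable Y μ) {θ B s : ℝ} (hθ : 0 < θ)
    (hint : Integrable (fun ω => Real.exp (θ * |Y ω|)) μ)
    (hB : ∫ ω, Real.exp (θ * |Y ω|) ∂μ ≤ B) (hmean : ∫ ω, Y ω ∂μ = 0)
    (hs0 : 0 ≤ s) (hs : s ≤ θ / 2) :
    ∫ ω, Real.exp (s * Y ω) ∂μ ≤ Real.exp (8 * B / θ ^ 2 * s ^ 2) := by
  have hYi : Integrable Y μ := by
    refine (hint.const_mul θ⁻¹).mono' hY (ae_of_all _ fun ω => ?_)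
    rw [Real.norm_eq_abs, inv_mul_eq_div, le_div_iff₀ hθ, mul_comm]
    linarith [Real.add_one_le_exp (θ * |Y ω|)]
  have hR : Integrable (fun ω => 1 + s * Y ω + 8 / θ ^ 2 * s ^ 2 * Real.exp (θ * |Y ω|)) μ :=
    ((integrable_const 1).add (hYi.const_mul s)).add (hint.const_mul _)
  have hint' : Integrable (fun ω => Real.exp (s * Y ω)) μ := by
    refine hR.mono' (Real.continuous_exp.comp_aestronglyMeasurable (hY.const_mul s))
      (ae_of_all _ fun ω => ?_)
    rw [Real.norm_eq_abs, Real.abs_exp]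
    exact Real.exp_mul_le_of_le_half hθ hs0 hs (Y ω)
  calc ∫ ω, Real.exp (s * Y ω) ∂μ
      ≤ ∫ ω, (1 + s * Y ω + 8 / θ ^ 2 * s ^ 2 * Real.exp (θ * |Y ω|)) ∂μ :=
        integral_mono hint' hR fun ω => Real.exp_mul_le_of_le_half hθ hs0 hs (Y ω)
    _ = 1 + 8 / θ ^ 2 * s ^ 2 * ∫ ω, Real.exp (θ * |Y ω|) ∂μ := by
        have h1 : Integrable (fun ω => 1 + s * Y ω) μ := (integrable_const 1).add (hYi.const_mul s)
        rw [integral_add h1 (hint.const_mul _), integral_add (integrable_const 1) (hYi.const_mul s),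
          integral_const_mul, integral_const_mul, hmean]
        simp
    _ ≤ 8 / θ ^ 2 * s ^ 2 * B + 1 := by
        rw [add_comm]; gcongr
    _ ≤ Real.exp (8 / θ ^ 2 * s ^ 2 * B) := Real.add_one_le_exp _
    _ = _ := by congr 1; ring

/-- The exponential moment of the norm of a random vector is controlled by the exponential moments
of its one-dimensional marginals, by averaging over the directions in the unit ball. -/
theorem lintegral_exp_norm_le_of_forall_inner {E : Type*} [NormedAddCommGroup E]
    [InnerProductSpace ℝ E] [FiniteDimensional ℝ E] [MeasurableSpace E] [BorelSpace E]
    (ν : Measure E) [SFinite ν] {t : ℝ} (ht : 0 ≤ t) {B : ENNReal}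
    (hB : ∀ u : E, ‖u‖ ≤ 1 → ∫⁻ y, ENNReal.ofReal (Real.exp (t * inner ℝ u y)) ∂ν ≤ B) :
    ∫⁻ y, ENNReal.ofReal (Real.exp (t * ‖y‖ / 2)) ∂ν ≤ 4 ^ Module.finrank ℝ E * B := by
  set D := Module.finrank ℝ E
  set b : ENNReal := volume (Metric.ball (0 : E) 1)
  have hb0 : b ≠ 0 := (Metric.measure_ball_pos volume (0 : E) one_pos).ne'
  have hbt : b ≠ ⊤ := measure_ball_lt_top.ne
  have key : ∀ y : E, ENNReal.ofReal ((1 / 4) ^ D) * b * ENNReal.ofReal (Real.exp (t * ‖y‖ / 2)) ≤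
      ∫⁻ u in Metric.ball (0 : E) 1, ENNReal.ofReal (Real.exp (t * inner ℝ u y)) := by
    intro y
    -- The ball of radius `1/4` about `c` lies in the unit ball and carries the fraction `4⁻ᴰ` of
    -- its volume. On it `⟨u, y⟩ ≥ (3/4 - 1/4) ‖y‖`. For `y = 0` the convention `0⁻¹ = 0` gives `c =
    -- 0`, which also works.
    set c : E := (3 / 4 * ‖y‖⁻¹) • y
    have hsub : Metric.ball c (1 / 4) ⊆ Metric.ball 0 1 := by
      refine Metric.ball_subset_ball' ?_
      have : dist c 0 ≤ 3 / 4 := by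
        rw [dist_zero_right, norm_smul, Real.norm_eq_abs, abs_of_nonneg (by positivity), mul_assoc]
        have := inv_mul_le_one (a := ‖y‖)
        linarith
      linarith
    rw [mul_comm, ← Measure.addHaar_ball_of_pos volume c (by norm_num), ← setLIntegral_const]
    refine (setLIntegral_mono' Metric.isOpen_ball.measurableSet fun u hu => ?_).trans
      (lintegral_mono_set hsub)
    refine ENNReal.ofReal_le_ofReal (Real.exp_le_exp.mpr ?_)
    rw [mul_div_assoc]
    refine mul_le_mul_of_nonneg_left ?_ ht
    have h1 : inner ℝ c y = 3 / 4 * ‖y‖ := by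
      rw [real_inner_smul_left, real_inner_self_eq_norm_sq]
      rcases eq_or_ne ‖y‖ 0 with h | h
      · simp [h]
      · field_simp
    have h2 : |inner ℝ (u - c) y| ≤ 1 / 4 * ‖y‖ :=
      (abs_real_inner_le_norm _ _).trans (mul_le_mul_of_nonneg_right
        (mem_ball_iff_norm.mp hu).le (norm_nonneg y))
    rw [inner_sub_left, h1] at h2
    linarith [(abs_le.mp h2).1]
  have hmeas : Measurable fun p : E × E => ENNReal.ofReal (Real.exp (t * inner ℝ p.2 p.1)) := by
    fun_prop
  have hmain : ENNReal.ofReal ((1 / 4) ^ D) * b *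
      ∫⁻ y, ENNReal.ofReal (Real.exp (t * ‖y‖ / 2)) ∂ν ≤ b * B := by
    rw [← lintegral_const_mul _ (by fun_prop)]
    refine (lintegral_mono key).trans ?_
    rw [lintegral_lintegral_swap hmeas.aemeasurable, mul_comm b, ← setLIntegral_const]
    refine setLIntegral_mono' Metric.isOpen_ball.measurableSet fun u hu => hB u ?_
    exact (mem_ball_zero_iff.mp hu).le
  have h4 : (4 : ENNReal) ^ D * ENNReal.ofReal ((1 / 4) ^ D) = 1 := by
    rw [← ENNReal.ofReal_ofNat 4, ← ENNReal.ofReal_pow (by norm_num),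
      ← ENNReal.ofReal_mul (by positivity), ← mul_pow]
    norm_num
  have hmain' : b * (ENNReal.ofReal ((1 / 4) ^ D) *
      ∫⁻ y, ENNReal.ofReal (Real.exp (t * ‖y‖ / 2)) ∂ν) ≤ b * B := by
    rwa [← mul_assoc, mul_comm b]
  rw [ENNReal.mul_le_mul_iff_right hb0 hbt] at hmain'
  calc _ = (4 : ENNReal) ^ D * (ENNReal.ofReal ((1 / 4) ^ D) *
      ∫⁻ y, ENNReal.ofReal (Real.exp (t * ‖y‖ / 2)) ∂ν) := by rw [← mul_assoc, h4, one_mul]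
    _ ≤ _ := by gcongr

/-! ### Sub-Gaussian estimates for random signs -/

/-- The sign `±1` encoded by a Boolean. -/
noncomputable def boolSign (b : Bool) : ℝ := if b then 1 else -1

/-- The constant `𝔼 exp (g² / 4)` for a standard Gaussian `g`. -/
noncomputable def gaussSqMoment : ℝ := ∫ g, Real.exp (g ^ 2 / 4) ∂(gaussianReal 0 1)

theorem integrable_exp_sq_gaussianReal :
    Integrable (fun g : ℝ => Real.exp (g ^ 2 / 4)) (gaussianReal 0 1) := by
  rw [gaussianReal_of_var_ne_zero _ one_ne_zero]
  rw [gaussianPDF_def, integrable_withDensity_iff_integrable_smul₀' (by fun_prop) (by simp)]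
  have h := (integrable_exp_neg_mul_sq (b := 1 / 4) (by norm_num)).const_mul (√(2 * Real.pi))⁻¹
  refine h.congr (ae_of_all _ fun g => ?_)
  simp only [gaussianPDFReal_def, NNReal.coe_one, mul_one, sub_zero, smul_eq_mul]
  rw [ENNReal.toReal_ofReal (by positivity), mul_assoc, ← Real.exp_add]
  congr 2
  ring

/-- Writing `exp (s² / 4)` as the Gaussian average of `exp (s g / √2)` makes the exponent linear in
the signs. The sum over signs then factorizes, and `cosh t ≤ exp (t² / 2)` bounds each factor. -/
theorem sum_exp_sq_rademacher_le {ι : Type*} [Fintype ι] [DecidableEq ι] (a : ι → ℝ)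
    (ha : ∑ i, a i ^ 2 ≤ 1) :
    ∑ ε : ι → Bool, Real.exp ((∑ i, a i * boolSign (ε i)) ^ 2 / 4)
      ≤ 2 ^ Fintype.card ι * gaussSqMoment := by
  have h1 (s : ℝ) : Real.exp (s ^ 2 / 4)
      = ∫ g, Real.exp (s / √2 * g) ∂(gaussianReal 0 1) := by
    have h := congrFun (mgf_id_gaussianReal (μ := 0) (v := 1)) (s / √2)
    rw [mgf] at h
    simp only [id] at h
    rw [h]
    congr 1
    rw [div_pow, Real.sq_sqrt (by norm_num), NNReal.coe_one]
    ring
  simp_rw [h1]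
  rw [← integral_finsetSum _ fun ε _ => integrable_exp_mul_gaussianReal _, gaussSqMoment,
    ← integral_const_mul]
  refine integral_mono (integrable_finsetSum _ fun ε _ => integrable_exp_mul_gaussianReal _)
    (integrable_exp_sq_gaussianReal.const_mul _) fun g => ?_
  change ∑ ε : ι → Bool, Real.exp ((∑ i, a i * boolSign (ε i)) / √2 * g)
    ≤ 2 ^ Fintype.card ι * Real.exp (g ^ 2 / 4)
  have h2 : ∀ ε : ι → Bool, Real.exp ((∑ i, a i * boolSign (ε i)) / √2 * g)
      = ∏ i, Real.exp (a i * boolSign (ε i) / √2 * g) := by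
    intro ε
    rw [← Real.exp_sum, Finset.sum_div, Finset.sum_mul]
  simp_rw [h2]
  have h3 := Finset.prod_univ_sum (fun _ : ι => (Finset.univ : Finset Bool))
    (fun i b => Real.exp (a i * boolSign b / √2 * g))
  rw [Fintype.piFinset_univ] at h3
  rw [← h3]
  have h4 : ∀ i, ∑ b, Real.exp (a i * boolSign b / √2 * g)
      ≤ 2 * Real.exp (a i ^ 2 * (g ^ 2 / 4)) := by
    intro i
    have h := Real.cosh_le_exp_half_sq (a i / √2 * g)
    rw [Real.cosh_eq] at h
    have h5 : (a i / √2 * g) ^ 2 / 2 = a i ^ 2 * (g ^ 2 / 4) := by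
      rw [mul_pow, div_pow, Real.sq_sqrt (by norm_num)]; ring
    rw [h5] at h
    rw [Fintype.sum_bool]
    simp only [boolSign, if_true, Bool.false_eq_true, if_false, mul_one, mul_neg_one, neg_div,
      neg_mul]
    linarith
  refine (Finset.prod_le_prod (fun i _ => Finset.sum_nonneg fun b _ => (Real.exp_pos _).le)
    fun i _ => h4 i).trans ?_
  rw [Finset.prod_mul_distrib, Finset.prod_const, Finset.card_univ, ← Real.exp_sum,
    ← Finset.sum_mul]
  gcongr
  nlinarith [sq_nonneg g]

/-- Jensen's inequality for the mean over `κ` reduces to a single linear form, so no independence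
between the forms is needed. -/
theorem sum_exp_sum_sq_rademacher_le {ι κ : Type*} [Fintype ι] [DecidableEq ι] [Fintype κ]
    [Nonempty κ] (a : κ → ι → ℝ) (ha : ∀ j, ∑ i, a j i ^ 2 ≤ 1) :
    ∑ ε : ι → Bool, Real.exp ((∑ j, (∑ i, a j i * boolSign (ε i)) ^ 2) / (4 * Fintype.card κ))
      ≤ 2 ^ Fintype.card ι * gaussSqMoment := by
  have hk : (0 : ℝ) < Fintype.card κ := by exact_mod_cast Fintype.card_pos
  have h1 (c : κ → ℝ) : Real.exp ((∑ j, c j) / (4 * Fintype.card κ))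
      ≤ ∑ j, (Fintype.card κ : ℝ)⁻¹ * Real.exp (c j / 4) := by
    have h := convexOn_exp.map_sum_le (t := Finset.univ) (w := fun _ : κ => (Fintype.card κ : ℝ)⁻¹)
      (p := fun j => c j / 4) (fun _ _ => by positivity)
      (by simp [hk.ne']) (fun _ _ => Set.mem_univ _)
    simp only [smul_eq_mul] at h
    rw [← Finset.mul_sum, ← Finset.sum_div] at h
    refine le_of_eq_of_le (congrArg Real.exp ?_) h
    field_simp
  refine (Finset.sum_le_sum fun ε _ => h1 _).trans ?_
  rw [Finset.sum_comm]
  simp_rw [← Finset.mul_sum]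
  refine (mul_le_mul_of_nonneg_left (Finset.sum_le_sum fun j _ => sum_exp_sq_rademacher_le (a j) (ha j))
    (by positivity)).trans_eq ?_
  rw [Finset.sum_const, Finset.card_univ, nsmul_eq_mul]
  field_simp

/-! ### Projections of a fixed vector and invariance of the Grassmannian measure -/

namespace PhaseRetrieval

variable {k d : ℕ}

theorem toEuclideanCLM_projMatrix (V : Grassmannian k d) :
    Matrix.toEuclideanCLM (n := Fin d) (𝕜 := ℝ) (projMatrix V) = V.1.starProjection := by
  rw [projMatrix, StarAlgEquiv.apply_symm_apply]

theorem toEuclideanLin_projMatrix (V : Grassmannian k d) (z : Euc d) :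
    Matrix.toEuclideanLin (projMatrix V) z = V.1.starProjection z := by
  rw [← toEuclideanCLM_projMatrix]
  rfl

theorem transpose_projMatrix (V : Grassmannian k d) : (projMatrix V).transpose = projMatrix V := by
  rw [← Matrix.conjTranspose_eq_transpose_of_trivial, ← Matrix.star_eq_conjTranspose]
  apply EquivLike.injective (Matrix.toEuclideanCLM (n := Fin d) (𝕜 := ℝ))
  rw [map_star, toEuclideanCLM_projMatrix]
  exact isSelfAdjoint_starProjection V.1

theorem continuous_projMatrix : Continuous (projMatrix : Grassmannian k d → Mat d) :=
  continuous_induced_dom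

theorem continuous_starProjection_apply (z : Euc d) :
    Continuous fun V : Grassmannian k d => V.1.starProjection z := by
  simp_rw [← toEuclideanLin_projMatrix]
  have h := continuous_projMatrix (k := k) (d := d)
  simp only [Matrix.toLpLin_apply]
  fun_prop

@[fun_prop]
theorem measurable_starProjection_apply (z : Euc d) :
    Measurable fun V : Grassmannian k d => V.1.starProjection z :=
  (continuous_starProjection_apply z).measurable

@[fun_prop]
theorem measurable_projNorm (z : Euc d) : Measurable fun V : Grassmannian k d => projNorm V z :=
  (measurable_starProjection_apply z).norm

theorem projNorm_nonneg (V : Grassmannian k d) (z : Euc d) : 0 ≤ projNorm V z := norm_nonneg _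

theorem projNorm_le (V : Grassmannian k d) (z : Euc d) : projNorm V z ≤ ‖z‖ :=
  V.1.norm_starProjection_apply_le z

theorem projNorm_smul (V : Grassmannian k d) (r : ℝ) (z : Euc d) :
    projNorm V (r • z) = |r| * projNorm V z := by
  rw [projNorm, map_smul, norm_smul, Real.norm_eq_abs, projNorm]

theorem inner_starProjection (V : Grassmannian k d) (u z : Euc d) :
    inner ℝ u (V.1.starProjection z) = inner ℝ (V.1.starProjection u) (V.1.starProjection z) := by
  rw [Submodule.inner_starProjection_left_eq_right, ← mul_apply_eq_comp,
    V.1.isIdempotentElem_starProjection.eq]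

theorem inner_starProjection_self (V : Grassmannian k d) (z : Euc d) :
    inner ℝ z (V.1.starProjection z) = projNorm V z ^ 2 := by
  rw [inner_starProjection, real_inner_self_eq_norm_sq, projNorm]

theorem norm_starProjection_sq_eq_sum {E : Type*} [NormedAddCommGroup E] [InnerProductSpace ℝ E]
    [FiniteDimensional ℝ E] (W : Submodule ℝ E) (z : E) :
    ‖W.starProjection z‖ ^ 2 = ∑ j, inner ℝ (stdOrthonormalBasis ℝ W j : E) z ^ 2 := by
  rw [Submodule.starProjection_apply, ← Submodule.coe_norm,
    ← (stdOrthonormalBasis ℝ W).sum_sq_inner_right]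
  refine Finset.sum_congr rfl fun j _ => ?_
  rw [Submodule.coe_inner, ← Submodule.starProjection_apply,
    ← Submodule.inner_starProjection_left_eq_right,
    Submodule.starProjection_eq_self_iff.mpr (Subtype.mem _)]

theorem projNorm_sq_eq_sum (V : Grassmannian k d) (z : Euc d) :
    projNorm V z ^ 2 = ∑ j, inner ℝ (stdOrthonormalBasis ℝ V.1 j : Euc d) z ^ 2 :=
  norm_starProjection_sq_eq_sum V.1 z

theorem starProjection_rotate (U : OrthGroup d) (V : Grassmannian k d) (z : Euc d) :
    (rotate U V).1.starProjection z
      = orthIsometry U (V.1.starProjection ((orthIsometry U).symm z)) :=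
  Submodule.starProjection_map_apply (orthIsometry U) V.1 z

theorem projNorm_rotate (U : OrthGroup d) (V : Grassmannian k d) (z : Euc d) :
    projNorm (rotate U V) (orthIsometry U z) = projNorm V z := by
  rw [projNorm, starProjection_rotate, LinearIsometryEquiv.norm_map,
    LinearIsometryEquiv.symm_apply_apply, projNorm]

theorem orthIsometry_mul (W U : OrthGroup d) (z : Euc d) :
    orthIsometry (W * U) z = orthIsometry W (orthIsometry U z) := by
  change Matrix.toEuclideanCLM (n := Fin d) (𝕜 := ℝ) (W.1 * U.1) z = _
  rw [map_mul]
  rfl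

theorem rotate_rotate (W U : OrthGroup d) (V : Grassmannian k d) :
    rotate W (rotate U V) = rotate (W * U) V := by
  refine Subtype.ext (Submodule.ext fun z => ?_)
  simp only [rotate, Submodule.mem_map]
  constructor
  · rintro ⟨_, ⟨y, hy, rfl⟩, rfl⟩
    exact ⟨y, hy, orthIsometry_mul W U y⟩
  · rintro ⟨y, hy, rfl⟩
    exact ⟨_, ⟨y, hy, rfl⟩, (orthIsometry_mul W U y).symm⟩

theorem continuous_rotate_right (U : OrthGroup d) :
    Continuous fun V : Grassmannian k d => rotate U V := by
  refine continuous_induced_rng.mpr ?_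
  have h : (projMatrix ∘ fun V : Grassmannian k d => rotate U V)
      = fun V => (U : Mat d) * projMatrix V * star (U : Mat d) :=
    funext fun V => projMatrix_rotate U V
  have h' := continuous_projMatrix (k := k) (d := d)
  rw [h]
  fun_prop

theorem map_rotate_grassmannMeasure (hkd : k ≤ d) (W : OrthGroup d) :
    (grassmannMeasure k d hkd).map (rotate W) = grassmannMeasure k d hkd := by
  have hm := (continuous_rotate (basePoint k d hkd)).measurable
  rw [grassmannMeasure, Measure.map_map (continuous_rotate_right W).measurable hm]
  have h : (rotate W ∘ fun U => rotate U (basePoint k d hkd))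
      = (fun U => rotate U (basePoint k d hkd)) ∘ (W * ·) :=
    funext fun U => rotate_rotate W U _
  have hinv : (haarOrth d).map (W * ·) = haarOrth d :=
    map_mul_left_eq_self (Measure.haarMeasure ⊤) W
  rw [h, ← Measure.map_map hm (measurable_const_mul W), hinv]

theorem integral_comp_rotate (hkd : k ≤ d) (W : OrthGroup d) {F : Grassmannian k d → ℝ}
    (hF : Measurable F) :
    ∫ V, F (rotate W V) ∂(grassmannMeasure k d hkd) = ∫ V, F V ∂(grassmannMeasure k d hkd) := by
  conv_rhs => rw [← map_rotate_grassmannMeasure hkd W]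
  rw [integral_map (continuous_rotate_right W).measurable.aemeasurable hF.aestronglyMeasurable]

theorem exists_orthIsometry_eq (L : Euc d ≃ₗᵢ[ℝ] Euc d) : ∃ U : OrthGroup d, orthIsometry U = L := by
  have hmem : (Matrix.toEuclideanCLM (n := Fin d) (𝕜 := ℝ)).symm
      (Unitary.linearIsometryEquiv.symm L).1 ∈ Matrix.unitaryGroup (Fin d) ℝ := by
    rw [Matrix.mem_unitaryGroup_iff]
    apply EquivLike.injective (Matrix.toEuclideanCLM (n := Fin d) (𝕜 := ℝ))
    rw [map_mul, map_star, StarAlgEquiv.apply_symm_apply, map_one]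
    exact (Unitary.mem_iff.mp (Unitary.linearIsometryEquiv.symm L).2).2
  refine ⟨⟨_, hmem⟩, ?_⟩
  refine LinearIsometryEquiv.ext fun z => ?_
  change Matrix.toEuclideanCLM (n := Fin d) (𝕜 := ℝ)
    ((Matrix.toEuclideanCLM (n := Fin d) (𝕜 := ℝ)).symm _) z = L z
  rw [StarAlgEquiv.apply_symm_apply]
  rfl

/-- The reflection in the hyperplane orthogonal to `u - v` exchanges two vectors of equal norm. -/
theorem exists_orthIsometry_apply_eq {u v : Euc d} (h : ‖u‖ = ‖v‖) :
    ∃ U : OrthGroup d, orthIsometry U u = v := by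
  obtain ⟨U, hU⟩ := exists_orthIsometry_eq (Submodule.reflection (ℝ ∙ (u - v))ᗮ)
  exact ⟨U, by rw [hU, Submodule.reflection_sub h]⟩

theorem integral_comp_projNorm_congr (hkd : k ≤ d) {g : ℝ → ℝ} (hg : Measurable g)
    {u v : Euc d} (h : ‖u‖ = ‖v‖) :
    ∫ V, g (projNorm V u) ∂(grassmannMeasure k d hkd)
      = ∫ V, g (projNorm V v) ∂(grassmannMeasure k d hkd) := by
  obtain ⟨U, rfl⟩ := exists_orthIsometry_apply_eq h
  rw [← integral_comp_rotate hkd U (F := fun V => g (projNorm V (orthIsometry U u))) (by fun_prop)]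
  simp_rw [projNorm_rotate]

theorem integrable_of_measurable_of_bound {hkd : k ≤ d} {F : Grassmannian k d → ℝ}
    (hF : Measurable F) {C : ℝ} (hC : ∀ V, |F V| ≤ C) : Integrable F (grassmannMeasure k d hkd) :=
  Integrable.of_bound hF.aestronglyMeasurable C (ae_of_all _ hC)

theorem sum_projNorm_sq_basisFun (V : Grassmannian k d) :
    ∑ i, projNorm V (EuclideanSpace.basisFun (Fin d) ℝ i) ^ 2 = k := by
  simp_rw [projNorm_sq_eq_sum]
  rw [Finset.sum_comm]
  simp_rw [OrthonormalBasis.sum_sq_inner_left, ← Submodule.coe_norm, OrthonormalBasis.norm_eq_one]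
  simp [V.2]

theorem integrable_projNorm_pow (hkd : k ≤ d) (m : ℕ) (u : Euc d) :
    Integrable (fun V => projNorm V u ^ m) (grassmannMeasure k d hkd) := by
  refine integrable_of_measurable_of_bound (by fun_prop) (C := ‖u‖ ^ m) fun V => ?_
  rw [abs_of_nonneg (pow_nonneg (projNorm_nonneg V u) m)]
  exact pow_le_pow_left₀ (projNorm_nonneg V u) (projNorm_le V u) m

/-- By invariance all `d` basis vectors give the same value, and their sum is the trace `k` of
`P_V`. -/
theorem integral_projNorm_sq (hkd : k ≤ d) {u : Euc d} (hu : ‖u‖ = 1) :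
    ∫ V, projNorm V u ^ 2 ∂(grassmannMeasure k d hkd) = k / d := by
  have hd : (d : ℝ) ≠ 0 := by
    rintro h
    obtain rfl : d = 0 := by exact_mod_cast h
    have : u = 0 := Subsingleton.elim _ _
    simp [this] at hu
  have h : ∀ i, ∫ V, projNorm V u ^ 2 ∂(grassmannMeasure k d hkd)
      = ∫ V, projNorm V (EuclideanSpace.basisFun (Fin d) ℝ i) ^ 2 ∂(grassmannMeasure k d hkd) :=
    fun i => integral_comp_projNorm_congr hkd (g := fun r => r ^ 2) (by fun_prop)
      (by rw [hu, OrthonormalBasis.norm_eq_one])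
  have h2 : (d : ℝ) * ∫ V, projNorm V u ^ 2 ∂(grassmannMeasure k d hkd) = k := by
    calc _ = ∑ _i : Fin d, ∫ V, projNorm V u ^ 2 ∂(grassmannMeasure k d hkd) := by simp
      _ = ∑ i : Fin d, ∫ V, projNorm V (EuclideanSpace.basisFun (Fin d) ℝ i) ^ 2
            ∂(grassmannMeasure k d hkd) := Finset.sum_congr rfl fun i _ => h i
      _ = k := by
        rw [← integral_finsetSum _ fun i _ => integrable_projNorm_pow hkd 2 _]
        simp_rw [sum_projNorm_sq_basisFun]
        simp
  rw [eq_div_iff hd, mul_comm, h2]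

/-! ### Exponential moments of projection lengths -/

/-- The vector of signs encoded by a Boolean vector. -/
noncomputable def signVec (ε : Fin d → Bool) : Euc d := WithLp.toLp 2 fun i => boolSign (ε i)

theorem boolSign_sq (b : Bool) : boolSign b ^ 2 = 1 := by
  cases b <;> simp [boolSign]

theorem norm_signVec (ε : Fin d → Bool) : ‖signVec ε‖ = √d := by
  rw [EuclideanSpace.norm_eq]
  simp [signVec, sq_abs, boolSign_sq]

theorem inner_signVec (a : Euc d) (ε : Fin d → Bool) :
    inner ℝ a (signVec ε) = ∑ i, a i * boolSign (ε i) := by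
  simp [PiLp.inner_apply, signVec, mul_comm]

theorem sum_exp_projNorm_signVec_le (hk : 1 ≤ k) (V : Grassmannian k d) :
    ∑ ε : Fin d → Bool, Real.exp (projNorm V (signVec ε) ^ 2 / (4 * k))
      ≤ 2 ^ d * gaussSqMoment := by
  have : Nonempty (Fin (Module.finrank ℝ V.1)) := ⟨⟨0, by rw [V.2]; exact hk⟩⟩
  have h := sum_exp_sum_sq_rademacher_le
    (fun j : Fin (Module.finrank ℝ V.1) => (stdOrthonormalBasis ℝ V.1 j : Euc d).ofLp) fun j => by
      have h1 : ‖(stdOrthonormalBasis ℝ V.1 j : Euc d)‖ = 1 := by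
        rw [← Submodule.coe_norm, OrthonormalBasis.norm_eq_one]
      rw [← EuclideanSpace.real_norm_sq_eq, h1, one_pow]
  simp only [Fintype.card_fin, V.2, ← inner_signVec, ← projNorm_sq_eq_sum] at h
  exact h

theorem integrable_exp_projNorm_sq (hkd : k ≤ d) {a : ℝ} (ha : 0 ≤ a) (u : Euc d) :
    Integrable (fun V => Real.exp (a * projNorm V u ^ 2)) (grassmannMeasure k d hkd) := by
  refine integrable_of_measurable_of_bound (by fun_prop) (C := Real.exp (a * ‖u‖ ^ 2)) fun V => ?_
  rw [Real.abs_exp]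
  have := projNorm_le V u
  have := projNorm_nonneg V u
  gcongr

/-- The squared length of the projection of a unit vector onto a uniformly distributed
`k`-dimensional subspace is sub-exponential at scale `k / d`. -/
theorem integral_exp_projNorm_sq_le (hk : 1 ≤ k) (hkd : k ≤ d) {u : Euc d} (hu : ‖u‖ ≤ 1) :
    ∫ V, Real.exp (d / (4 * k) * projNorm V u ^ 2) ∂(grassmannMeasure k d hkd)
      ≤ gaussSqMoment := by
  have hd : 0 < d := by omega
  obtain ⟨v, hv, huv⟩ : ∃ v : Euc d, ‖v‖ = 1 ∧ u = ‖u‖ • v := by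
    by_cases h0 : u = 0
    · exact ⟨EuclideanSpace.basisFun (Fin d) ℝ ⟨0, hd⟩, by simp, by simp [h0]⟩
    · have : ‖u‖ ≠ 0 := norm_ne_zero_iff.mpr h0
      exact ⟨‖u‖⁻¹ • u, by simp [norm_smul, this], by rw [smul_smul, mul_inv_cancel₀ this, one_smul]⟩
  have h1 : ∫ V, Real.exp (d / (4 * k) * projNorm V u ^ 2) ∂(grassmannMeasure k d hkd)
      ≤ ∫ V, Real.exp (d / (4 * k) * projNorm V v ^ 2) ∂(grassmannMeasure k d hkd) := by
    refine integral_mono (integrable_exp_projNorm_sq hkd (by positivity) u)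
      (integrable_exp_projNorm_sq hkd (by positivity) v) fun V => ?_
    have h2 : projNorm V u ≤ projNorm V v := by
      rw [huv, projNorm_smul, abs_norm]
      exact mul_le_of_le_one_left (projNorm_nonneg V v) hu
    have := projNorm_nonneg V u
    dsimp only
    gcongr
  refine h1.trans ?_
  -- Every sign vector has norm `√d`, the norm of `√d • v`. The integral for `v` thus equals its
  -- average over all `2 ^ d` sign vectors, and that average is bounded for each fixed `V`.
  have h2 (ε : Fin d → Bool) : ∫ V, Real.exp (d / (4 * k) * projNorm V v ^ 2)
        ∂(grassmannMeasure k d hkd)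
      = ∫ V, Real.exp ((4 * k : ℝ)⁻¹ * projNorm V (signVec ε) ^ 2) ∂(grassmannMeasure k d hkd) := by
    have h3 := integral_comp_projNorm_congr hkd
      (g := fun r => Real.exp ((4 * k : ℝ)⁻¹ * r ^ 2)) (by fun_prop)
      (u := √d • v) (v := signVec ε) (by
        rw [norm_smul, hv, mul_one, norm_signVec, Real.norm_eq_abs, abs_of_nonneg (by positivity)])
    rw [← h3]
    simp_rw [projNorm_smul, mul_pow, sq_abs, Real.sq_sqrt (Nat.cast_nonneg d), ← mul_assoc,
      inv_mul_eq_div]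
  have h4 : (2 : ℝ) ^ d * ∫ V, Real.exp (d / (4 * k) * projNorm V v ^ 2)
      ∂(grassmannMeasure k d hkd) ≤ 2 ^ d * gaussSqMoment := by
    calc _ = ∑ ε : Fin d → Bool, ∫ V, Real.exp ((4 * k : ℝ)⁻¹ * projNorm V (signVec ε) ^ 2)
          ∂(grassmannMeasure k d hkd) := by
          rw [← Finset.sum_congr rfl fun ε _ => h2 ε]
          simp
      _ = ∫ V, ∑ ε : Fin d → Bool, Real.exp ((4 * k : ℝ)⁻¹ * projNorm V (signVec ε) ^ 2)
          ∂(grassmannMeasure k d hkd) :=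
        (integral_finsetSum _ fun ε _ => integrable_exp_projNorm_sq hkd (by positivity) _).symm
      _ ≤ ∫ _V, 2 ^ d * gaussSqMoment ∂(grassmannMeasure k d hkd) := by
        refine integral_mono
          (integrable_finsetSum _ fun ε _ => integrable_exp_projNorm_sq hkd (by positivity) _)
          (integrable_const _) fun V => ?_
        refine le_of_eq_of_le (Finset.sum_congr rfl fun ε _ => ?_)
          (sum_exp_projNorm_signVec_le hk V)
        rw [inv_mul_eq_div]
      _ = _ := by simp
  exact le_of_mul_le_mul_left h4 (by positivity)

end PhaseRetrieval

/-! ### The summands of the certificate -/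

namespace PhaseRetrieval

variable {k d : ℕ}

theorem measurableSet_cutoff (β : ℝ) (x : Euc d) : MeasurableSet (cutoff k β x) :=
  measurableSet_le (by fun_prop) measurable_const

@[fun_prop]
theorem measurable_certCoeff (hkd : k ≤ d) (β : ℝ) (x : Euc d) :
    Measurable (certCoeff k d hkd β x) := by
  have h : Measurable ((cutoff k β x).indicator fun V : Grassmannian k d => projNorm V x ^ 2) :=
    Measurable.indicator (by fun_prop) (measurableSet_cutoff β x)
  unfold certCoeff
  fun_prop

/-- This makes the coefficient invariant under rotations that fix `x`. -/
theorem certCoeff_congr (hkd : k ≤ d) (β : ℝ) (x : Euc d) {V W : Grassmannian k d}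
    (h : projNorm V x = projNorm W x) : certCoeff k d hkd β x V = certCoeff k d hkd β x W := by
  have hm : V ∈ cutoff k β x ↔ W ∈ cutoff k β x := by
    simp only [cutoff, Set.mem_ofPred_eq, h]
  rw [certCoeff, certCoeff]
  by_cases hV : V ∈ cutoff k β x
  · rw [Set.indicator_of_mem hV, Set.indicator_of_mem (hm.mp hV), h]
  · rw [Set.indicator_of_notMem hV, Set.indicator_of_notMem (mt hm.mpr hV)]

theorem projNorm_sq_le_of_mem_cutoff (hk : 1 ≤ k) {β : ℝ} {x : Euc d}
    {V : Grassmannian k d} (hV : V ∈ cutoff k β x) :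
    d * projNorm V x ^ 2 ≤ 4 * β ^ 2 * k := by
  have hk' : (0 : ℝ) < k := by exact_mod_cast hk
  have h0 : 0 ≤ √(d / k) * projNorm V x := mul_nonneg (Real.sqrt_nonneg _) (projNorm_nonneg V x)
  have h := pow_le_pow_left₀ h0 hV 2
  rw [mul_pow, Real.sq_sqrt (by positivity), div_mul_eq_mul_div, div_le_iff₀ hk'] at h
  linarith

theorem indicator_projNorm_sq_mem_Icc (hk : 1 ≤ k) (β : ℝ) (x : Euc d)
    (V : Grassmannian k d) :
    d * (cutoff k β x).indicator (fun V => projNorm V x ^ 2) V ∈ Set.Icc 0 (4 * β ^ 2 * k) := by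
  by_cases hV : V ∈ cutoff k β x
  · rw [Set.indicator_of_mem hV]
    exact ⟨by positivity, projNorm_sq_le_of_mem_cutoff hk hV⟩
  · rw [Set.indicator_of_notMem hV, mul_zero]
    exact ⟨le_rfl, by positivity⟩

theorem indicator_projNorm_pow_four (β : ℝ) (x : Euc d) (V : Grassmannian k d) :
    (cutoff k β x).indicator (fun V => projNorm V x ^ 4) V
      = (cutoff k β x).indicator (fun V => projNorm V x ^ 2) V * projNorm V x ^ 2 := by
  by_cases hV : V ∈ cutoff k β x
  · rw [Set.indicator_of_mem hV, Set.indicator_of_mem hV]; ring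
  · rw [Set.indicator_of_notMem hV, Set.indicator_of_notMem hV, zero_mul]

theorem integrable_indicator_projNorm_pow (hkd : k ≤ d) (β : ℝ) (x : Euc d) (m : ℕ) :
    Integrable ((cutoff k β x).indicator fun V => projNorm V x ^ m) (grassmannMeasure k d hkd) :=
  (integrable_projNorm_pow hkd m x).indicator (measurableSet_cutoff β x)

/-- On the cut-off event one factor `‖P_V x‖²` is at most `4β²k/d`; the other has mean `k/d`. -/
theorem certAlpha_mem_Icc (hk : 1 ≤ k) (hkd : k ≤ d) (β : ℝ) {x : Euc d} (hx : ‖x‖ = 1) :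
    certAlpha k d hkd β x ∈ Set.Icc 0 (4 * β ^ 2 * k) := by
  have hk' : (0 : ℝ) < k := by exact_mod_cast hk
  have hd' : (0 : ℝ) < d := by exact_mod_cast (show 0 < d by omega)
  constructor
  · refine mul_nonneg (by positivity) (integral_nonneg fun V => ?_)
    exact Set.indicator_nonneg (fun V _ => pow_nonneg (projNorm_nonneg V x) 4) V
  · have h : ∫ V, (cutoff k β x).indicator (fun V => projNorm V x ^ 4) V
        ∂(grassmannMeasure k d hkd) ≤ 4 * β ^ 2 * k / d * (k / d) := by
      rw [← integral_projNorm_sq hkd hx, ← integral_const_mul]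
      refine integral_mono (integrable_indicator_projNorm_pow hkd β x 4)
        ((integrable_projNorm_pow hkd 2 x).const_mul _) fun V => ?_
      dsimp only
      rw [indicator_projNorm_pow_four]
      refine mul_le_mul_of_nonneg_right ?_ (by positivity)
      rw [le_div_iff₀ hd', mul_comm]
      exact (indicator_projNorm_sq_mem_Icc hk β x V).2
    refine (mul_le_mul_of_nonneg_left h (by positivity)).trans_eq ?_
    field_simp

theorem abs_certCoeff_le (hk : 1 ≤ k) (hkd : k ≤ d) (β : ℝ) {x : Euc d} (hx : ‖x‖ = 1)
    (V : Grassmannian k d) : |certCoeff k d hkd β x V| ≤ 4 * β ^ 2 * k := by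
  have h1 := certAlpha_mem_Icc hk hkd β hx
  have h2 := indicator_projNorm_sq_mem_Icc hk β x V
  rw [certCoeff, abs_le]
  constructor <;> linarith [h1.1, h1.2, h2.1, h2.2]

theorem integrable_certCoeff_mul_inner (hk : 1 ≤ k) (hkd : k ≤ d) (β : ℝ) {x : Euc d}
    (hx : ‖x‖ = 1) (u : Euc d) :
    Integrable (fun V : Grassmannian k d => certCoeff k d hkd β x V
      * inner ℝ u (V.1.starProjection x)) (grassmannMeasure k d hkd) := by
  refine integrable_of_measurable_of_bound (by fun_prop) (C := 4 * β ^ 2 * k * ‖u‖) fun V => ?_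
  rw [abs_mul]
  refine mul_le_mul (abs_certCoeff_le hk hkd β hx V) ?_ (abs_nonneg _) (by positivity)
  refine (abs_real_inner_le_norm _ _).trans (mul_le_of_le_one_right (norm_nonneg u) ?_)
  exact (projNorm_le V x).trans_eq hx

theorem integral_certCoeff_mul_projNorm_sq (hk : 1 ≤ k) (hkd : k ≤ d) (β : ℝ) {x : Euc d}
    (hx : ‖x‖ = 1) :
    ∫ V, certCoeff k d hkd β x V * projNorm V x ^ 2 ∂(grassmannMeasure k d hkd) = 0 := by
  have hk' : (k : ℝ) ≠ 0 := by exact_mod_cast (show k ≠ 0 by omega)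
  have hd' : (d : ℝ) ≠ 0 := by exact_mod_cast (show d ≠ 0 by omega)
  simp_rw [certCoeff, sub_mul, mul_assoc, ← indicator_projNorm_pow_four]
  rw [integral_sub ((integrable_projNorm_pow hkd 2 x).const_mul _)
    ((integrable_indicator_projNorm_pow hkd β x 4).const_mul _), integral_const_mul,
    integral_const_mul, integral_projNorm_sq hkd hx, certAlpha]
  field_simp
  ring

/-- The reflection across `ℝ x` fixes `x` and sends `u` to `2⟨x, u⟩ x - u`. Invariance therefore
gives `I(u) = 2⟨x, u⟩ I(x) - I(u)` for the integral `I`, and `I(x) = 0` by the choice of `α`. -/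
theorem integral_certCoeff_mul_inner (hk : 1 ≤ k) (hkd : k ≤ d) (β : ℝ) {x : Euc d}
    (hx : ‖x‖ = 1) (u : Euc d) :
    ∫ V, certCoeff k d hkd β x V * inner ℝ u (V.1.starProjection x)
      ∂(grassmannMeasure k d hkd) = 0 := by
  obtain ⟨U, hU⟩ := exists_orthIsometry_eq (Submodule.reflection (ℝ ∙ x))
  have hUx : orthIsometry U x = x := by
    rw [hU]
    exact Submodule.reflection_mem_subspace_eq_self (Submodule.mem_span_singleton_self x)
  have hUu : orthIsometry U u = (2 * inner ℝ x u) • x - u := by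
    rw [hU, Submodule.reflection_singleton_apply, hx]
    simp [two_smul, two_mul, add_smul]
  have h1 : ∀ V : Grassmannian k d, certCoeff k d hkd β x (rotate U V)
      * inner ℝ u ((rotate U V).1.starProjection x)
      = 2 * inner ℝ x u * (certCoeff k d hkd β x V * projNorm V x ^ 2)
        - certCoeff k d hkd β x V * inner ℝ u (V.1.starProjection x) := by
    intro V
    have h2 : certCoeff k d hkd β x (rotate U V) = certCoeff k d hkd β x V := by
      refine certCoeff_congr hkd β x ?_
      conv_lhs => rw [← hUx]
      exact projNorm_rotate U V x
    have h3 : (orthIsometry U).symm x = x := by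
      conv_lhs => rw [← hUx]
      exact (orthIsometry U).symm_apply_apply x
    have h4 : inner ℝ u (orthIsometry U (V.1.starProjection x))
        = inner ℝ (orthIsometry U u) (V.1.starProjection x) := by
      conv_rhs => rw [← (orthIsometry U).inner_map_map, hU, Submodule.reflection_reflection, ← hU]
    rw [h2, starProjection_rotate, h3, h4, hUu, inner_sub_left, real_inner_smul_left,
      inner_starProjection_self]
    ring
  have hp : Integrable (fun V => certCoeff k d hkd β x V * projNorm V x ^ 2)
      (grassmannMeasure k d hkd) := by
    simp_rw [← inner_starProjection_self]
    exact integrable_certCoeff_mul_inner hk hkd β hx x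
  have h5 := integral_comp_rotate hkd U (F := fun V => certCoeff k d hkd β x V
    * inner ℝ u (V.1.starProjection x)) (by fun_prop)
  simp_rw [h1] at h5
  rw [integral_sub (hp.const_mul _) (integrable_certCoeff_mul_inner hk hkd β hx u),
    integral_const_mul, integral_certCoeff_mul_projNorm_sq hk hkd β hx] at h5
  linarith

/-- The summand `(d/k) λ P_V x` of the certificate, applied to `x`. -/
noncomputable def certVec (k d : ℕ) (hkd : k ≤ d) (β : ℝ) (x : Euc d) (V : Grassmannian k d) : Euc d :=
  (d / k * certCoeff k d hkd β x V) • V.1.starProjection x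

@[fun_prop]
theorem measurable_certVec (hkd : k ≤ d) (β : ℝ) (x : Euc d) :
    Measurable (certVec k d hkd β x) := by
  unfold certVec
  fun_prop

theorem toEuclideanLin_dualCertificate (hkd : k ≤ d) (β : ℝ) (x : Euc d) {n : ℕ}
    (V : Fin n → Grassmannian k d) :
    Matrix.toEuclideanLin (dualCertificate k d hkd β x V) x
      = (n : ℝ)⁻¹ • ∑ j, certVec k d hkd β x (V j) := by
  rw [dualCertificate, map_smul, map_sum, LinearMap.smul_apply, LinearMap.sum_apply,
    Finset.smul_sum, Finset.smul_sum]
  refine Finset.sum_congr rfl fun j _ => ?_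
  rw [map_smul, LinearMap.smul_apply, toEuclideanLin_projMatrix, certVec, smul_smul, smul_smul]
  congr 1
  field_simp

theorem transpose_dualCertificate (hkd : k ≤ d) (β : ℝ) (x : Euc d) {n : ℕ}
    (V : Fin n → Grassmannian k d) :
    (dualCertificate k d hkd β x V).transpose = dualCertificate k d hkd β x V := by
  simp only [dualCertificate, Matrix.transpose_smul, Matrix.transpose_sum, transpose_projMatrix]

theorem abs_inner_certVec_le (hk : 1 ≤ k) (hkd : k ≤ d) (β : ℝ) {x : Euc d} (hx : ‖x‖ = 1)
    (u : Euc d) (V : Grassmannian k d) :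
    |inner ℝ u (certVec k d hkd β x V)|
      ≤ 2 * β ^ 2 * d * (projNorm V u ^ 2 + projNorm V x ^ 2) := by
  have hk' : (0 : ℝ) < k := by exact_mod_cast hk
  rw [certVec, real_inner_smul_right, abs_mul, abs_mul, abs_of_nonneg (by positivity),
    inner_starProjection]
  have h1 : |inner ℝ (V.1.starProjection u) (V.1.starProjection x)|
      ≤ (projNorm V u ^ 2 + projNorm V x ^ 2) / 2 := by
    refine (abs_real_inner_le_norm _ _).trans ?_
    change projNorm V u * projNorm V x ≤ _
    linarith [two_mul_le_add_sq (projNorm V u) (projNorm V x)]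
  calc _ ≤ d / k * (4 * β ^ 2 * k) * ((projNorm V u ^ 2 + projNorm V x ^ 2) / 2) := by
        gcongr
        exact abs_certCoeff_le hk hkd β hx V
    _ = _ := by field_simp; ring

/-- The factor `1 / (16β²k)` turns the bound `2β²d (‖P_V u‖² + ‖P_V x‖²)` into the mean of the two
exponents `d/(4k) ‖P_V ·‖²`; then `exp ((p + q) / 2) ≤ (exp p + exp q) / 2`. -/
theorem integral_exp_abs_inner_certVec_le (hk : 1 ≤ k) (hkd : k ≤ d) {β : ℝ} (hβ : 0 < β)
    {x : Euc d} (hx : ‖x‖ = 1) {u : Euc d} (hu : ‖u‖ ≤ 1) :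
    Integrable (fun V => Real.exp (1 / (16 * β ^ 2 * k) * |inner ℝ u (certVec k d hkd β x V)|))
      (grassmannMeasure k d hkd) ∧
    ∫ V, Real.exp (1 / (16 * β ^ 2 * k) * |inner ℝ u (certVec k d hkd β x V)|)
      ∂(grassmannMeasure k d hkd) ≤ gaussSqMoment := by
  have hk' : (0 : ℝ) < k := by exact_mod_cast hk
  have hiu := integrable_exp_projNorm_sq hkd (a := d / (4 * k)) (by positivity) u
  have hix := integrable_exp_projNorm_sq hkd (a := d / (4 * k)) (by positivity) x
  have hpt : ∀ V : Grassmannian k d,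
      Real.exp (1 / (16 * β ^ 2 * k) * |inner ℝ u (certVec k d hkd β x V)|)
      ≤ (1 / 2) * (Real.exp (d / (4 * k) * projNorm V u ^ 2)
        + Real.exp (d / (4 * k) * projNorm V x ^ 2)) := by
    intro V
    set p := d / (4 * k) * projNorm V u ^ 2
    set q := d / (4 * k) * projNorm V x ^ 2
    have h1 : 1 / (16 * β ^ 2 * k) * |inner ℝ u (certVec k d hkd β x V)| ≤ p / 2 + q / 2 := by
      refine (mul_le_mul_of_nonneg_left (abs_inner_certVec_le hk hkd β hx u V)
        (by positivity)).trans_eq ?_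
      simp only [p, q]
      field_simp
      ring
    refine (Real.exp_le_exp.mpr h1).trans ?_
    have h2 : Real.exp p = Real.exp (p / 2) ^ 2 := by rw [← Real.exp_nat_mul]; congr 1; push_cast; ring
    have h3 : Real.exp q = Real.exp (q / 2) ^ 2 := by rw [← Real.exp_nat_mul]; congr 1; push_cast; ring
    rw [Real.exp_add, h2, h3]
    linarith [two_mul_le_add_sq (Real.exp (p / 2)) (Real.exp (q / 2))]
  have hint : Integrable (fun V => Real.exp (1 / (16 * β ^ 2 * k)
      * |inner ℝ u (certVec k d hkd β x V)|)) (grassmannMeasure k d hkd) := by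
    refine ((hiu.add hix).const_mul (1 / 2)).mono'
      (Measurable.aestronglyMeasurable (by fun_prop)) (ae_of_all _ fun V => ?_)
    rw [Real.norm_eq_abs, Real.abs_exp]
    exact hpt V
  refine ⟨hint, (integral_mono hint ((hiu.add hix).const_mul (1 / 2)) hpt).trans ?_⟩
  rw [integral_const_mul]
  simp only [Pi.add_apply]
  rw [integral_add hiu hix]
  linarith [integral_exp_projNorm_sq_le hk hkd hu, integral_exp_projNorm_sq_le hk hkd hx.le]

theorem integral_exp_inner_certVec_le (hk : 1 ≤ k) (hkd : k ≤ d) {β : ℝ} (hβ : 0 < β)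
    {x : Euc d} (hx : ‖x‖ = 1) {u : Euc d} (hu : ‖u‖ ≤ 1) {s : ℝ} (hs0 : 0 ≤ s)
    (hs : s ≤ 1 / (16 * β ^ 2 * k) / 2) :
    ∫ V, Real.exp (s * inner ℝ u (certVec k d hkd β x V)) ∂(grassmannMeasure k d hkd)
      ≤ Real.exp (8 * gaussSqMoment / (1 / (16 * β ^ 2 * k)) ^ 2 * s ^ 2) := by
  have hk' : (0 : ℝ) < k := by exact_mod_cast hk
  have h := integral_exp_abs_inner_certVec_le hk hkd hβ hx hu
  refine integral_exp_mul_le_of_integral_eq_zero (Measurable.aestronglyMeasurable (by fun_prop))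
    (by positivity) h.1 h.2 ?_ hs0 hs
  simp_rw [certVec, real_inner_smul_right, mul_assoc]
  rw [integral_const_mul, integral_certCoeff_mul_inner hk hkd β hx u, mul_zero]

theorem norm_certVec_le (hk : 1 ≤ k) (hkd : k ≤ d) (β : ℝ) {x : Euc d} (hx : ‖x‖ = 1)
    (V : Grassmannian k d) : ‖certVec k d hkd β x V‖ ≤ d / k * (4 * β ^ 2 * k) := by
  rw [certVec, norm_smul, Real.norm_eq_abs, abs_mul, abs_of_nonneg (by positivity)]
  have h : ‖V.1.starProjection x‖ ≤ 1 := (projNorm_le V x).trans_eq hx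
  have h' := abs_certCoeff_le hk hkd β hx V
  calc _ ≤ d / k * (4 * β ^ 2 * k) * 1 := by gcongr
    _ = _ := mul_one _

theorem lintegral_exp_inner_sum_certVec_le (hk : 1 ≤ k) (hkd : k ≤ d) {β : ℝ} (hβ : 0 < β)
    {x : Euc d} (hx : ‖x‖ = 1) {n : ℕ} {Ω : Type*} [MeasurableSpace Ω] {P : Measure Ω}
    [IsProbabilityMeasure P] {V : Fin n → Ω → Grassmannian k d}
    (hV : ∀ j, HasLaw (V j) (grassmannMeasure k d hkd) P) (hind : iIndepFun V P)
    {s : ℝ} (hs0 : 0 ≤ s) (hs : s ≤ 1 / (16 * β ^ 2 * k) / 2) {u : Euc d} (hu : ‖u‖ ≤ 1) :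
    ∫⁻ ω, ENNReal.ofReal (Real.exp (s * inner ℝ u (∑ j, certVec k d hkd β x (V j ω)))) ∂P
      ≤ ENNReal.ofReal
        (Real.exp (8 * gaussSqMoment / (1 / (16 * β ^ 2 * k)) ^ 2 * s ^ 2) ^ n) := by
  have hm : ∀ j, AEMeasurable (V j) P := fun j => (hV j).aemeasurable
  have hmc : ∀ j, AEMeasurable (fun ω => certVec k d hkd β x (V j ω)) P := fun j =>
    (measurable_certVec hkd β x).comp_aemeasurable (hm j)
  have hms : AEMeasurable (fun ω => ∑ j, certVec k d hkd β x (V j ω)) P :=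
    Finset.aemeasurable_fun_sum _ fun j _ => hmc j
  have hprod : ∀ ω, Real.exp (s * inner ℝ u (∑ j, certVec k d hkd β x (V j ω)))
      = ∏ j, Real.exp (s * inner ℝ u (certVec k d hkd β x (V j ω))) := by
    intro ω
    rw [inner_sum, Finset.mul_sum, Real.exp_sum]
  have hint : Integrable
      (fun ω => Real.exp (s * inner ℝ u (∑ j, certVec k d hkd β x (V j ω)))) P := by
    -- This crude bound, growing with `n` and `d`, serves only integrability.
    refine Integrable.of_bound (AEMeasurable.aestronglyMeasurable (by fun_prop))
      (Real.exp (s * (n * (d / k * (4 * β ^ 2 * k))))) (ae_of_all _ fun ω => ?_)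
    rw [Real.norm_eq_abs, Real.abs_exp, Real.exp_le_exp]
    refine mul_le_mul_of_nonneg_left ((real_inner_le_norm _ _).trans
      ((mul_le_of_le_one_left (norm_nonneg _) hu).trans ((norm_sum_le _ _).trans ?_))) hs0
    refine (Finset.sum_le_card_nsmul _ _ _ fun j _ => norm_certVec_le hk hkd β hx (V j ω)).trans_eq ?_
    rw [Finset.card_univ, Fintype.card_fin, nsmul_eq_mul]
  rw [← ofReal_integral_eq_lintegral_ofReal hint (ae_of_all _ fun ω => (Real.exp_pos _).le)]
  refine ENNReal.ofReal_le_ofReal ?_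
  simp_rw [hprod]
  rw [iIndepFun.integral_fun_prod_comp hind hm
    (f := fun _ W => Real.exp (s * inner ℝ u (certVec k d hkd β x W)))
    fun j => Measurable.aestronglyMeasurable (by fun_prop)]
  refine (Finset.prod_le_prod (fun j _ => integral_nonneg fun ω => (Real.exp_pos _).le)
    fun j _ => ?_).trans_eq (by rw [Finset.prod_const, Finset.card_univ, Fintype.card_fin])
  have h := (hV j).integral_comp
    (f := fun W => Real.exp (s * inner ℝ u (certVec k d hkd β x W)))
    (Measurable.aestronglyMeasurable (by fun_prop))
  exact h.trans_le (integral_exp_inner_certVec_le hk hkd hβ hx hu hs0 hs)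

theorem lintegral_exp_norm_sum_certVec_le (hk : 1 ≤ k) (hkd : k ≤ d) {β : ℝ} (hβ : 0 < β)
    {x : Euc d} (hx : ‖x‖ = 1) {n : ℕ} {Ω : Type*} [MeasurableSpace Ω] {P : Measure Ω}
    [IsProbabilityMeasure P] {V : Fin n → Ω → Grassmannian k d}
    (hV : ∀ j, HasLaw (V j) (grassmannMeasure k d hkd) P) (hind : iIndepFun V P)
    {s : ℝ} (hs0 : 0 ≤ s) (hs : s ≤ 1 / (16 * β ^ 2 * k) / 2) :
    ∫⁻ ω, ENNReal.ofReal (Real.exp (s * ‖∑ j, certVec k d hkd β x (V j ω)‖ / 2)) ∂P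
      ≤ ENNReal.ofReal (4 ^ d *
        Real.exp (8 * gaussSqMoment / (1 / (16 * β ^ 2 * k)) ^ 2 * s ^ 2) ^ n) := by
  have hmc : ∀ j, AEMeasurable (fun ω => certVec k d hkd β x (V j ω)) P := fun j =>
    (measurable_certVec hkd β x).comp_aemeasurable (hV j).aemeasurable
  have hms : AEMeasurable (fun ω => ∑ j, certVec k d hkd β x (V j ω)) P :=
    Finset.aemeasurable_fun_sum _ fun j _ => hmc j
  have h := lintegral_exp_norm_le_of_forall_inner
    (P.map fun ω => ∑ j, certVec k d hkd β x (V j ω)) hs0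
    (B := ENNReal.ofReal
      (Real.exp (8 * gaussSqMoment / (1 / (16 * β ^ 2 * k)) ^ 2 * s ^ 2) ^ n)) fun u hu => by
      rw [lintegral_map' (by fun_prop) hms]
      exact lintegral_exp_inner_sum_certVec_le hk hkd hβ hx hV hind hs0 hs hu
  rw [lintegral_map' (by fun_prop) hms, finrank_euclideanSpace_fin] at h
  rwa [ENNReal.ofReal_mul (by positivity), ENNReal.ofReal_pow (by norm_num), ENNReal.ofReal_ofNat]

theorem gaussSqMoment_pos : 0 < gaussSqMoment := integral_exp_pos integrable_exp_sq_gaussianReal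

end PhaseRetrieval

/-! ### Choice of constants and Markov's inequality -/

theorem theorem5p8 (k : ℕ) (hk : 1 ≤ k) (γ β : ℝ) (hγ : 0 < γ) (hβ : 0 < β) :
    ∃ c C : ℝ, 0 < c ∧ 0 < C ∧
      ∀ (d : ℕ) (hkd : k ≤ d) (x : EuclideanSpace ℝ (Fin d)), ‖x‖ = 1 →
      ∀ n : ℕ, c * (d : ℝ) ≤ (n : ℝ) →
      ∀ {Ω : Type*} [MeasurableSpace Ω] (P : Measure Ω) [IsProbabilityMeasure P]
        (V : Fin n → Ω → PhaseRetrieval.Grassmannian k d),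
        (∀ j, HasLaw (V j) (PhaseRetrieval.grassmannMeasure k d hkd) P) →
        iIndepFun V P →
        1 - Real.exp (-C * (n : ℝ)) ≤
          P.real {ω | PhaseRetrieval.nuclearNorm (PhaseRetrieval.tangentProj x
            (PhaseRetrieval.dualCertificate k d hkd β x fun j => V j ω)) ≤ γ} := by
  have hk' : (0 : ℝ) < k := by exact_mod_cast hk
  set θ : ℝ := 1 / (16 * β ^ 2 * k) with hθ
  have hθ0 : 0 < θ := by positivity
  set K : ℝ := 8 * gaussSqMoment / θ ^ 2 with hK
  have hK0 : 0 < K := by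
    have := PhaseRetrieval.gaussSqMoment_pos
    positivity
  -- The first bound is the range of the moment estimate; the second makes `n K s²` at most half of
  -- the gain `n s γ / 8` in Markov's inequality.
  set s : ℝ := min (θ / 2) (γ / (16 * K)) with hs
  have hs0 : 0 < s := lt_min (by positivity) (by positivity)
  have hsK : K * s ^ 2 ≤ s * γ / 16 := by
    have h : s ≤ γ / (16 * K) := min_le_right _ _
    rw [le_div_iff₀ (by positivity)] at h
    nlinarith
  -- In units of `s γ n / 32` the exponent is at most `1` from `4 ^ d`, plus `2` from `n K s²`,
  -- minus `4` from the threshold, hence at most `-1`.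
  refine ⟨32 * Real.log 4 / (s * γ), s * γ / 32,
    div_pos (mul_pos (by norm_num) (Real.log_pos (by norm_num))) (by positivity), by positivity, ?_⟩
  intro d hkd x hx n hn Ω _ P _ V hV hind
  have hd : 0 < (d : ℝ) := by exact_mod_cast (show 0 < d by omega)
  have hdn : d * Real.log 4 ≤ s * γ / 32 * n := by
    rw [div_mul_eq_mul_div, div_le_iff₀ (by positivity)] at hn
    linarith
  have hn0 : 0 < (n : ℝ) := by
    have h := mul_pos hd (Real.log_pos (x := 4) (by norm_num))
    exact (pos_iff_pos_of_mul_pos (h.trans_le hdn)).mp (by positivity)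
  set G := {ω | PhaseRetrieval.nuclearNorm (PhaseRetrieval.tangentProj x
    (PhaseRetrieval.dualCertificate k d hkd β x fun j => V j ω)) ≤ γ}
  -- Failure of the bound forces the norm of the sum above `n γ / 4`, because `‖Y_T‖₁ ≤ 4 ‖Y x‖`.
  set A := {ω | ENNReal.ofReal (Real.exp (s * (n * γ / 4) / 2)) ≤ ENNReal.ofReal
    (Real.exp (s * ‖∑ j, PhaseRetrieval.certVec k d hkd β x (V j ω)‖ / 2))}
  have hGA : Gᶜ ⊆ A := by
    intro ω hω
    have hω' : ¬ PhaseRetrieval.nuclearNorm (PhaseRetrieval.tangentProj x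
      (PhaseRetrieval.dualCertificate k d hkd β x fun j => V j ω)) ≤ γ := hω
    have h1 : γ < 4 * ‖(n : ℝ)⁻¹ • ∑ j, PhaseRetrieval.certVec k d hkd β x (V j ω)‖ := by
      rw [← PhaseRetrieval.toEuclideanLin_dualCertificate]
      exact (not_le.mp hω').trans_le (PhaseRetrieval.nuclearNorm_tangentProj_le hx
        (PhaseRetrieval.transpose_dualCertificate hkd β x _))
    rw [norm_smul, norm_inv, Real.norm_natCast, inv_mul_eq_div, mul_div_assoc', lt_div_iff₀ hn0] at h1
    refine ENNReal.ofReal_le_ofReal (Real.exp_le_exp.mpr ?_)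
    gcongr
    linarith
  have hmark := mul_meas_ge_le_lintegral₀ (μ := P) (f := fun ω => ENNReal.ofReal
    (Real.exp (s * ‖∑ j, PhaseRetrieval.certVec k d hkd β x (V j ω)‖ / 2))) (by
      have hmc : ∀ j, AEMeasurable (fun ω => PhaseRetrieval.certVec k d hkd β x (V j ω)) P :=
        fun j => (PhaseRetrieval.measurable_certVec hkd β x).comp_aemeasurable (hV j).aemeasurable
      have hms : AEMeasurable (fun ω => ∑ j, PhaseRetrieval.certVec k d hkd β x (V j ω)) P :=
        Finset.aemeasurable_fun_sum _ fun j _ => hmc j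
      fun_prop) (ENNReal.ofReal (Real.exp (s * (n * γ / 4) / 2)))
  have hA : P.real A ≤ Real.exp (-(s * γ / 32) * n) := by
    have h1 := hmark.trans (PhaseRetrieval.lintegral_exp_norm_sum_certVec_le hk hkd hβ hx hV hind
      hs0.le (min_le_left _ _))
    have h2 := ENNReal.toReal_mono ENNReal.ofReal_ne_top h1
    rw [ENNReal.toReal_mul, ENNReal.toReal_ofReal (Real.exp_pos _).le,
      ENNReal.toReal_ofReal (by positivity)] at h2
    change Real.exp (s * (n * γ / 4) / 2) * P.real A ≤ _ at h2
    rw [← hθ, ← hK, ← Real.exp_nat_mul] at h2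
    have h4 : (4 : ℝ) ^ d = Real.exp (d * Real.log 4) := by
      rw [Real.exp_nat_mul, Real.exp_log (by norm_num)]
    rw [h4, ← Real.exp_add, mul_comm, ← le_div_iff₀ (Real.exp_pos _), ← Real.exp_sub] at h2
    refine h2.trans (Real.exp_le_exp.mpr ?_)
    have h5 := mul_le_mul_of_nonneg_left hsK hn0.le
    linarith
  have hcompl : P.real Gᶜ ≤ P.real A := measureReal_mono hGA
  -- Subadditivity suffices here and avoids proving `G` measurable.
  have htot : 1 ≤ P.real G + P.real Gᶜ := by
    have h := measureReal_union_le (μ := P) G Gᶜ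
    rwa [Set.union_compl_self, probReal_univ] at h
  linarith
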